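/- Let $N\ge 1$ and let $a_1,\dots,a_N\in\mathbb C$ with $\sum_{k=1}^N|a_k|^2=1$. Consider the $N$-qubit generalized W-class state $$|\psi\rangle_{A_1\cdots A_N}=a_1|10\cdots0\rangle+a_2|01\cdots0\rangle+\cdots+a_N|0\cdots01\rangle .$$ For a bipartite pure state (unit vector) $|\varphi\rangle_{AB}$ the concurrence is $C(|\varphi\rangle_{AB})=\sqrt{2\,(1-\mathrm{Tr}\,\rho_A^2)}$ with $\rho_A=\mathrm{Tr}_B|\varphi\rangle\langle\varphi|$. For a bipartite mixed state $\rho_{AB}$, the concurrence and the concurrence of assistance are $$C(\rho_{AB})=\min\sum_m p_m C(|\varphi_m\rangle),\qquad C_a(\rho_{AB})=\max\sum_m p_m C(|\varphi_m\rangle),$$ where the minimum and the maximum are over all finite decompositions $\rho_{AB}=\sum_m p_m|\varphi_m\rangle\langle\varphi_m|$ into pure states with $p_m\ge 0$, $\sum_m p_m=1$. Let $\rho_{A_pA_q}$ be the reduced density matrix of $|\psi\rangle\langle\psi|$ on the qubits $A_p,A_q$ (viewed as a bipartite state of $A_p$ and $A_q$), and let $C(|\psi\rangle_{A_iA_j|\overline{A_iA_j}})$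 be the concurrence of $|\psi\rangle$ viewed as a bipartite pure state of the pair $A_iA_j$ and of all the remaining qubits. Then: 1. For all $p\ne q$ in $\{1,\dots,N\}$, the minimum and the maximum defining $C(\rho_{A_pA_q})$ and $C_a(\rho_{A_pA_q})$ are attained, and $C(\rho_{A_pA_q})=C_a(\rho_{A_pA_q})$. 2. For all $1\le i<j\le N$, with $I=\{1,\dots,N\}\setminus\{i,j\}$, $$\Bigl|\sum_{t\in I}\bigl[C^2(\rho_{A_iA_t})-C^2(\rho_{A_jA_t})\bigr]\Bigr|\;\le\; C^2(|\psi\rangle_{A_iA_j|\overline{A_iA_j}})\;\le\; 2C^2(\rho_{A_iA_j})+\sum_{t\in I}\bigl[C^2(\rho_{A_iA_t})+C^2(\rho_{A_jA_t})\bigr].$$ -/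

import Mathlib

open scoped BigOperators

noncomputable section

/-- The rank-one operator `|ψ⟩⟨ψ|`, as a matrix in the computational basis. -/
def ketBra {α : Type*} (ψ : EuclideanSpace ℂ α) : Matrix α α ℂ :=
  Matrix.of fun x y => ψ x * star (ψ y)

/-- The partial trace over the second factor. -/
def traceRight {α β : Type*} [Fintype β] (M : Matrix (α × β) (α × β) ℂ) : Matrix α α ℂ :=
  Matrix.of fun a a' => ∑ b, M (a, b) (a', b)

/-- The concurrence `√(2 (1 - Tr ρ_A²))` of a bipartite pure state `|ψ⟩_{AB}`. -/
def pureConcurrence {α β : Type*} [Fintype α] [Fintype β]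
    (ψ : EuclideanSpace ℂ (α × β)) : ℝ :=
  √(2 * (1 - (traceRight (ketBra ψ) * traceRight (ketBra ψ)).trace.re))

/-- A decomposition `ρ = ∑ i, p i • |ψ i⟩⟨ψ i|` of a bipartite density matrix into finitely many
pure states (unit vectors) with probabilities `p i`. -/
structure PureDecomposition {α β : Type*} [Fintype α] [Fintype β]
    (ρ : Matrix (α × β) (α × β) ℂ) where
  size : ℕ
  prob : Fin size → ℝ
  state : Fin size → EuclideanSpace ℂ (α × β)
  prob_nonneg : ∀ i, 0 ≤ prob i
  prob_sum : ∑ i, prob i = 1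
  norm_state : ∀ i, ‖state i‖ = 1
  sum_eq : ρ = ∑ i, (prob i : ℂ) • ketBra (state i)

/-- The average concurrence `∑ i, p i * C(|ψ i⟩)` of a pure state decomposition. -/
def PureDecomposition.average {α β : Type*} [Fintype α] [Fintype β]
    {ρ : Matrix (α × β) (α × β) ℂ} (d : PureDecomposition ρ) : ℝ :=
  ∑ i, d.prob i * pureConcurrence (d.state i)

/-- The set of average concurrences of all pure state decompositions of `ρ`. -/
def averageConcurrences {α β : Type*} [Fintype α] [Fintype β]
    (ρ : Matrix (α × β) (α × β) ℂ) : Set ℝ :=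
  Set.range fun d : PureDecomposition ρ => d.average

/-- The concurrence of a mixed state: the convex roof of `pureConcurrence`. -/
def concurrence {α β : Type*} [Fintype α] [Fintype β]
    (ρ : Matrix (α × β) (α × β) ℂ) : ℝ :=
  sInf (averageConcurrences ρ)

/-- The concurrence of assistance of a mixed state: the concave roof of `pureConcurrence`. -/
def concurrenceOfAssistance {α β : Type*} [Fintype α] [Fintype β]
    (ρ : Matrix (α × β) (α × β) ℂ) : ℝ :=
  sSup (averageConcurrences ρ)

/-- An `N`-qubit vector viewed as a bipartite vector: the qubits in `S` form the first factor,
the remaining qubits form the second factor. -/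
def bipartition {N : ℕ} (S : Finset (Fin N)) (ψ : EuclideanSpace ℂ (Fin N → Fin 2)) :
    EuclideanSpace ℂ (({k // k ∈ S} → Fin 2) × ({k // k ∉ S} → Fin 2)) :=
  WithLp.toLp 2 fun x => ψ ((Equiv.piEquivPiSubtypeProd (· ∈ S) fun _ => Fin 2).symm x)

/-- The reduced density matrix of `|ψ⟩⟨ψ|` on the qubits in `S`. -/
def reducedState {N : ℕ} (ψ : EuclideanSpace ℂ (Fin N → Fin 2)) (S : Finset (Fin N)) :
    Matrix ({k // k ∈ S} → Fin 2) ({k // k ∈ S} → Fin 2) ℂ :=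
  traceRight (ketBra (bipartition S ψ))

/-- The configuration of the qubits `p` and `q` with value `x.1` at `p` and `x.2` at `q`
(a bijection for `p ≠ q`). -/
def pairConfig {N : ℕ} (p q : Fin N) (x : Fin 2 × Fin 2) :
    {k // k ∈ ({p, q} : Finset (Fin N))} → Fin 2 :=
  fun k => if (k : Fin N) = p then x.1 else x.2

/-- The reduced density matrix of two distinct qubits `p` and `q`, as a bipartite density matrix
with `p` as the first and `q` as the second factor. -/
def reducedPair {N : ℕ} (ψ : EuclideanSpace ℂ (Fin N → Fin 2)) (p q : Fin N) :
    Matrix (Fin 2 × Fin 2) (Fin 2 × Fin 2) ℂ :=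
  (reducedState ψ {p, q}).submatrix (pairConfig p q) (pairConfig p q)

/-- The generalized W-class vector `a₁|10⋯0⟩ + a₂|01⋯0⟩ + ⋯ + a_N|0⋯01⟩`. -/
def wState {N : ℕ} (a : Fin N → ℂ) : EuclideanSpace ℂ (Fin N → Fin 2) :=
  ∑ k, a k • EuclideanSpace.single (Pi.single k 1 : Fin N → Fin 2) (1 : ℂ)

end

/-! The two-qubit reduction is `|v⟩⟨v| + s |00⟩⟨00|` with `v = a_p |10⟩ + a_q |01⟩`, so it has no
weight on `|11⟩`. In any decomposition, every `φ` of positive probability thus has `φ (1, 1) = 0`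
and concurrence `2 ‖φ (0, 1)‖ ‖φ (1, 0)‖`. The average of these is squeezed: the triangle inequality
on the entry `(01, 10)` bounds it below by `2 ‖a p‖ ‖a q‖`, and Cauchy–Schwarz with the two diagonal
entries bounds it above by the same number. All decompositions therefore have equal average
(`PureDecomposition.average_wState`), and both roofs coincide.

For the second part, with `s` the weight outside `{i, j}`, the squared concurrence of the cut is `4
(‖a i‖² + ‖a j‖²) s`, while the two sums over `t` are `4 ‖a i‖² s` and `4 ‖a j‖² s`. Both
inequalities are then elementary. -/

/-- The coefficients of `a_p |10⟩ + a_q |01⟩`. -/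
def excitationPart (u v : ℂ) (x : Fin 2 × Fin 2) : ℂ :=
  if x = (1, 0) then u else if x = (0, 1) then v else 0

/-! ### Two-qubit reductions of a W-class state -/

theorem wState_apply {N : ℕ} (a : Fin N → ℂ) (x : Fin N → Fin 2) :
    wState a x = ∑ k, a k * if x = Pi.single k 1 then 1 else 0 := by
  simp [wState, Pi.single_apply]

theorem pairConfig_bijective {N : ℕ} {p q : Fin N} (h : p ≠ q) :
    Function.Bijective (pairConfig p q) := by
  constructor
  · intro x y hxy
    have h1 := congrFun hxy ⟨p, by simp⟩
    have h2 := congrFun hxy ⟨q, by simp⟩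
    simp only [pairConfig, if_true, if_neg h.symm] at h1 h2
    exact Prod.ext h1 h2
  · intro f
    refine ⟨(f ⟨p, by simp⟩, f ⟨q, by simp⟩), ?_⟩
    funext ⟨k, hk⟩
    rcases Finset.mem_insert.1 hk with rfl | hk'
    · simp [pairConfig]
    · obtain rfl := Finset.mem_singleton.1 hk'
      simp [pairConfig, h.symm]

theorem combine_apply_left {N : ℕ} {p q : Fin N} (x : Fin 2 × Fin 2)
    (r : {k // k ∉ ({p, q} : Finset (Fin N))} → Fin 2) :
    (Equiv.piEquivPiSubtypeProd (· ∈ ({p, q} : Finset (Fin N))) fun _ => Fin 2).symm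
      (pairConfig p q x, r) p = x.1 := by
  simp [Equiv.piEquivPiSubtypeProd, pairConfig]

theorem combine_apply_right {N : ℕ} {p q : Fin N} (h : p ≠ q) (x : Fin 2 × Fin 2)
    (r : {k // k ∉ ({p, q} : Finset (Fin N))} → Fin 2) :
    (Equiv.piEquivPiSubtypeProd (· ∈ ({p, q} : Finset (Fin N))) fun _ => Fin 2).symm
      (pairConfig p q x, r) q = x.2 := by
  simp [Equiv.piEquivPiSubtypeProd, pairConfig, h.symm]

theorem combine_apply_rest {N : ℕ} {p q : Fin N} (x : Fin 2 × Fin 2)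
    (r : {k // k ∉ ({p, q} : Finset (Fin N))} → Fin 2)
    (k : {k // k ∉ ({p, q} : Finset (Fin N))}) :
    (Equiv.piEquivPiSubtypeProd (· ∈ ({p, q} : Finset (Fin N))) fun _ => Fin 2).symm
      (pairConfig p q x, r) k = r k := by
  have := k.2
  simp only [Equiv.piEquivPiSubtypeProd, Equiv.coe_fn_symm_mk, dif_neg this]

theorem combine_eq_iff {N : ℕ} {p q : Fin N} (h : p ≠ q) (x : Fin 2 × Fin 2)
    (r : {k // k ∉ ({p, q} : Finset (Fin N))} → Fin 2) (y : Fin N → Fin 2) :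
    (Equiv.piEquivPiSubtypeProd (· ∈ ({p, q} : Finset (Fin N))) fun _ => Fin 2).symm
      (pairConfig p q x, r) = y ↔ x = (y p, y q) ∧ r = fun k : {k // k ∉ ({p, q} : Finset (Fin N))} => y k := by
  constructor
  · rintro rfl
    refine ⟨?_, ?_⟩
    · rw [combine_apply_left, combine_apply_right h]
    · funext k
      rw [combine_apply_rest]
  · rintro ⟨rfl, rfl⟩
    funext k
    by_cases hk : k ∈ ({p, q} : Finset (Fin N))
    · rcases Finset.mem_insert.1 hk with rfl | hk'
      · rw [combine_apply_left]
      · obtain rfl := Finset.mem_singleton.1 hk'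
        rw [combine_apply_right h]
    · exact combine_apply_rest _ _ ⟨k, hk⟩

/-- The single excitation sits either in the pair, leaving the rest in the zero configuration, or
outside it, leaving the pair in `|00⟩`. -/
theorem wState_combine {N : ℕ} (a : Fin N → ℂ) {p q : Fin N} (h : p ≠ q) (x : Fin 2 × Fin 2)
    (r : {k // k ∉ ({p, q} : Finset (Fin N))} → Fin 2) :
    bipartition {p, q} (wState a) (pairConfig p q x, r) =
      (if r = 0 then excitationPart (a p) (a q) x else 0) +
      (if x = (0, 0) then ∑ k : {k // k ∉ ({p, q} : Finset (Fin N))},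
        a k * (if r = Pi.single k 1 then 1 else 0) else 0) := by
  have hb : bipartition {p, q} (wState a) (pairConfig p q x, r) = wState a
    ((Equiv.piEquivPiSubtypeProd (· ∈ ({p, q} : Finset (Fin N))) fun _ => Fin 2).symm
      (pairConfig p q x, r)) := rfl
  have hc := fun k => propext (combine_eq_iff h x r (Pi.single k 1))
  rw [hb, wState_apply]
  simp only [hc]
  rw [← Finset.sum_add_sum_compl ({p, q} : Finset (Fin N)), Finset.sum_pair h]
  congr 1
  · have hp : (fun k : {k // k ∉ ({p, q} : Finset (Fin N))} =>
        (Pi.single p 1 : Fin N → Fin 2) k) = 0 := by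
      funext ⟨k, hk⟩
      simp only [Finset.mem_insert, Finset.mem_singleton, not_or] at hk
      simp [hk.1]
    have hq : (fun k : {k // k ∉ ({p, q} : Finset (Fin N))} =>
        (Pi.single q 1 : Fin N → Fin 2) k) = 0 := by
      funext ⟨k, hk⟩
      simp only [Finset.mem_insert, Finset.mem_singleton, not_or] at hk
      simp [hk.2]
    rw [hp, hq]
    by_cases hr : r = 0
    · simp only [hr, Pi.single_eq_same, Pi.single_eq_of_ne h, Pi.single_eq_of_ne h.symm,
        excitationPart, and_true, if_true]
      by_cases h1 : x = (1, 0)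
      · simp [h1]
      · simp [h1]
    · simp [hr]
  · have hk : ∀ k ∈ ({p, q} : Finset (Fin N))ᶜ,
        (Pi.single k 1 : Fin N → Fin 2) p = 0 ∧ (Pi.single k 1 : Fin N → Fin 2) q = 0 := by
      intro k hk
      simp only [Finset.mem_compl, Finset.mem_insert, Finset.mem_singleton, not_or] at hk
      exact ⟨Pi.single_eq_of_ne' hk.1 _, Pi.single_eq_of_ne' hk.2 _⟩
    rw [Finset.sum_subtype (p := fun k => k ∉ ({p, q} : Finset (Fin N))) _ (by simp)]
    split_ifs with hx
    · refine Finset.sum_congr rfl fun k _ => ?_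
      have hs : (fun l : {k // k ∉ ({p, q} : Finset (Fin N))} =>
          (Pi.single (k : Fin N) 1 : Fin N → Fin 2) l) = Pi.single k 1 := by
        funext l
        simp [Pi.single_apply, Subtype.ext_iff]
      obtain ⟨h1, h2⟩ := hk k (by simpa using k.2)
      rw [h1, h2, hs]
      simp [hx]
    · refine Finset.sum_eq_zero fun k _ => ?_
      obtain ⟨h1, h2⟩ := hk k (by simpa using k.2)
      rw [h1, h2]
      simp [hx]

/-- Distinct indices hit distinct configurations, so all cross terms vanish. -/
theorem sum_mul_star_of_injective {κ R : Type*} [Fintype κ] [Fintype R] [DecidableEq R]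
    (a : κ → ℂ) {f : κ → R} (hf : Function.Injective f) :
    ∑ r, (∑ k, a k * (if r = f k then 1 else 0)) * star (∑ k, a k * (if r = f k then 1 else 0)) =
      ((∑ k, ‖a k‖ ^ 2 : ℝ) : ℂ) := by
  classical
  simp only [star_sum, Finset.sum_mul_sum]
  rw [Finset.sum_comm]
  push_cast
  refine Finset.sum_congr rfl fun k _ => ?_
  rw [Finset.sum_comm, Finset.sum_eq_single k]
  · simp [Complex.mul_conj', apply_ite]
  · intro l _ hl
    refine Finset.sum_eq_zero fun r _ => ?_
    by_cases h1 : r = f k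
    · have : r ≠ f l := fun h2 => hl (hf (h2.symm.trans h1))
      simp [this]
    · simp [h1]
  · simp

/-- The reduced state of two qubits of a W-class state is
`|v⟩⟨v| + (∑_{k ≠ p, q} |a_k|²) |00⟩⟨00|` with `v = a_p |10⟩ + a_q |01⟩`. -/
theorem reducedPair_wState {N : ℕ} (a : Fin N → ℂ) {p q : Fin N} (h : p ≠ q)
    (x y : Fin 2 × Fin 2) :
    reducedPair (wState a) p q x y =
      excitationPart (a p) (a q) x * star (excitationPart (a p) (a q) y) +
      if x = (0, 0) ∧ y = (0, 0) then
        ((∑ k ∈ Finset.univ \ {p, q}, ‖a k‖ ^ 2 : ℝ) : ℂ) else 0 := by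
  have hb : reducedPair (wState a) p q x y =
      ∑ r, bipartition {p, q} (wState a) (pairConfig p q x, r) *
        star (bipartition {p, q} (wState a) (pairConfig p q y, r)) := rfl
  rw [hb]
  simp only [wState_combine a h]
  set B : ({k // k ∉ ({p, q} : Finset (Fin N))} → Fin 2) → ℂ := fun r =>
    ∑ k : {k // k ∉ ({p, q} : Finset (Fin N))}, a k * (if r = Pi.single k 1 then 1 else 0) with hB
  -- The two branches have disjoint supports in `r`; this removes the cross terms in `hterm`.
  have hB0 : B 0 = 0 := by
    refine Finset.sum_eq_zero fun k _ => ?_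
    have : (0 : {k // k ∉ ({p, q} : Finset (Fin N))} → Fin 2) ≠ Pi.single k 1 := by
      intro h0
      simpa using congrFun h0 k
    simp [this]
  have hsum : ∑ r, B r * star (B r) = ((∑ k ∈ Finset.univ \ {p, q}, ‖a k‖ ^ 2 : ℝ) : ℂ) := by
    rw [hB]
    rw [sum_mul_star_of_injective (fun k : {k // k ∉ ({p, q} : Finset (Fin N))} => a k)
      (f := fun k => Pi.single k 1)]
    · rw [Finset.sum_subtype (p := fun k => k ∉ ({p, q} : Finset (Fin N))) _ (by simp)]
    · intro k l hkl
      by_contra hne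
      have := congrFun hkl k
      simp [hne] at this
  have hterm : ∀ r, ((if r = 0 then excitationPart (a p) (a q) x else 0) +
        (if x = (0, 0) then B r else 0)) *
      star ((if r = 0 then excitationPart (a p) (a q) y else 0) +
        (if y = (0, 0) then B r else 0)) =
      (if r = 0 then excitationPart (a p) (a q) x * star (excitationPart (a p) (a q) y) else 0) +
      (if x = (0, 0) ∧ y = (0, 0) then B r * star (B r) else 0) := by
    intro r
    by_cases hr : r = 0
    · simp [hr, hB0]
    · by_cases hx : x = (0, 0) <;> by_cases hy : y = (0, 0) <;> simp [hr, hx, hy]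
  change ∑ r, ((if r = 0 then excitationPart (a p) (a q) x else 0) +
        (if x = (0, 0) then B r else 0)) *
      star ((if r = 0 then excitationPart (a p) (a q) y else 0) +
        (if y = (0, 0) then B r else 0)) = _
  simp only [hterm, Finset.sum_add_distrib, Finset.sum_ite_eq', Finset.mem_univ, if_true]
  congr 1
  split_ifs
  · exact hsum
  · simp

/-! ### Average concurrence of pure state decompositions -/

/-- A 2×2 matrix `ρ` of trace 1 satisfies `Tr ρ² = 1 - 2 det ρ`, and here `det ρ` is the squared
modulus of the determinant of the coefficient matrix. -/
theorem pureConcurrence_qubits (φ : EuclideanSpace ℂ (Fin 2 × Fin 2)) (hφ : ‖φ‖ = 1) :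
    pureConcurrence φ = 2 * ‖φ (0, 0) * φ (1, 1) - φ (0, 1) * φ (1, 0)‖ := by
  have hn : ‖φ‖ ^ 2 = 1 := by rw [hφ]; norm_num
  rw [EuclideanSpace.norm_sq_eq, Fintype.sum_prod_type] at hn
  simp only [Fin.sum_univ_two, Complex.sq_norm, Complex.normSq_apply] at hn
  rw [pureConcurrence, ← Real.sqrt_sq (by positivity :
    0 ≤ 2 * ‖φ (0, 0) * φ (1, 1) - φ (0, 1) * φ (1, 0)‖)]
  congr 1
  rw [mul_pow, Complex.sq_norm, Complex.normSq_apply]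
  simp only [Matrix.trace, Matrix.diag, Matrix.mul_apply, traceRight, ketBra, Matrix.of_apply,
    Fin.sum_univ_two, Complex.add_re, Complex.mul_re, Complex.add_im, Complex.mul_im,
    Complex.star_def, Complex.conj_re, Complex.conj_im, Complex.sub_re, Complex.sub_im]
  generalize φ (0, 0) = u at *
  generalize φ (0, 1) = v at *
  generalize φ (1, 0) = w at *
  generalize φ (1, 1) = z at *
  -- With `n = ‖φ‖²`, the two sides differ by `2 (1 - n²) = -2 (n + 1) (n - 1)`.
  linear_combination (-2 * (u.re * u.re + u.im * u.im + (v.re * v.re + v.im * v.im) +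
    (w.re * w.re + w.im * w.im + (z.re * z.re + z.im * z.im)) + 1)) * hn

/-- Normalization that also covers `u = 0`, where any unit vector serves with weight zero; this
occurs when `a p = a q = 0`. -/
theorem exists_unit_smul_ketBra {α : Type*} [Fintype α] [Nonempty α] (u : EuclideanSpace ℂ α) :
    ∃ φ : EuclideanSpace ℂ α, ‖φ‖ = 1 ∧ ((‖u‖ ^ 2 : ℝ) : ℂ) • ketBra φ = ketBra u := by
  classical
  by_cases hu : u = 0
  · refine ⟨EuclideanSpace.single (Classical.arbitrary α) 1, by simp, ?_⟩
    ext x y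
    simp [hu, ketBra]
  · have hn : ‖u‖ ≠ 0 := norm_ne_zero_iff.2 hu
    refine ⟨((‖u‖⁻¹ : ℝ) : ℂ) • u, ?_, ?_⟩
    · rw [norm_smul]
      simp [hn]
    · have hc : (‖u‖ : ℂ) ≠ 0 := by exact_mod_cast hn
      ext x y
      simp [ketBra]
      field_simp

/-- Diagonal entries of a decomposed density matrix. -/
theorem PureDecomposition.sum_diag {α β : Type*} [Fintype α] [Fintype β]
    {ρ : Matrix (α × β) (α × β) ℂ} (d : PureDecomposition ρ) (x : α × β) :
    ρ x x = ((∑ i, d.prob i * ‖d.state i x‖ ^ 2 : ℝ) : ℂ) := by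
  have h : ρ x x = (∑ i, (d.prob i : ℂ) • ketBra (d.state i)) x x :=
    congrFun (congrFun d.sum_eq x) x
  rw [h, Matrix.sum_apply]
  push_cast
  refine Finset.sum_congr rfl fun i _ => ?_
  simp [ketBra, Complex.mul_conj']

theorem PureDecomposition.norm_entry_le {α β : Type*} [Fintype α] [Fintype β]
    {ρ : Matrix (α × β) (α × β) ℂ} (d : PureDecomposition ρ) (x y : α × β) :
    ‖ρ x y‖ ≤ ∑ i, d.prob i * (‖d.state i x‖ * ‖d.state i y‖) := by
  have h : ρ x y = (∑ i, (d.prob i : ℂ) • ketBra (d.state i)) x y :=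
    congrFun (congrFun d.sum_eq x) y
  rw [h, Matrix.sum_apply]
  refine (norm_sum_le _ _).trans_eq (Finset.sum_congr rfl fun i _ => ?_)
  simp [ketBra, abs_of_nonneg (d.prob_nonneg i)]

theorem PureDecomposition.average_wState {N : ℕ} (a : Fin N → ℂ) {p q : Fin N} (h : p ≠ q)
    (d : PureDecomposition (reducedPair (wState a) p q)) :
    d.average = 2 * (‖a p‖ * ‖a q‖) := by
  have e11 : ∑ i, d.prob i * ‖d.state i (1, 1)‖ ^ 2 = 0 := by
    have := d.sum_diag (1, 1)
    rw [reducedPair_wState a h] at this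
    simp only [excitationPart] at this
    norm_num at this
    exact_mod_cast this.symm
  have e10 : ∑ i, d.prob i * ‖d.state i (1, 0)‖ ^ 2 = ‖a p‖ ^ 2 := by
    have := d.sum_diag (1, 0)
    rw [reducedPair_wState a h] at this
    simp only [excitationPart] at this
    norm_num [Complex.mul_conj'] at this
    exact_mod_cast this.symm
  have e01 : ∑ i, d.prob i * ‖d.state i (0, 1)‖ ^ 2 = ‖a q‖ ^ 2 := by
    have := d.sum_diag (0, 1)
    rw [reducedPair_wState a h] at this
    simp only [excitationPart] at this
    norm_num [Complex.mul_conj'] at this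
    exact_mod_cast this.symm
  have hle : ‖a q‖ * ‖a p‖ ≤ ∑ i, d.prob i * (‖d.state i (0, 1)‖ * ‖d.state i (1, 0)‖) := by
    have := d.norm_entry_le (0, 1) (1, 0)
    rw [reducedPair_wState a h] at this
    simp only [excitationPart] at this
    norm_num at this
    exact this
  -- Cauchy–Schwarz with weights `d.prob i`.
  have hge : ∑ i, d.prob i * (‖d.state i (0, 1)‖ * ‖d.state i (1, 0)‖) ≤ ‖a q‖ * ‖a p‖ := by
    refine le_of_sq_le_sq ?_ (by positivity)
    rw [mul_pow, ← e10, ← e01]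
    refine Finset.sum_sq_le_sum_mul_sum_of_sq_le_mul _
      (fun i _ => mul_nonneg (d.prob_nonneg i) (sq_nonneg _))
      (fun i _ => mul_nonneg (d.prob_nonneg i) (sq_nonneg _)) fun i _ => (by ring : _ = _).le
  have havg : d.average = 2 * ∑ i, d.prob i * (‖d.state i (0, 1)‖ * ‖d.state i (1, 0)‖) := by
    rw [PureDecomposition.average, Finset.mul_sum]
    refine Finset.sum_congr rfl fun i _ => ?_
    -- Each term of the vanishing `|11⟩` weight is zero: either the probability or the amplitude
    -- vanishes.
    have h0 := (Finset.sum_eq_zero_iff_of_nonneg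
      (fun i _ => mul_nonneg (d.prob_nonneg i) (sq_nonneg _))).1 e11 i (Finset.mem_univ i)
    rcases mul_eq_zero.1 h0 with h0 | h0
    · simp [h0]
    · have h1 : d.state i (1, 1) = 0 := norm_eq_zero.1 (pow_eq_zero_iff two_ne_zero |>.1 h0)
      rw [pureConcurrence_qubits _ (d.norm_state i), h1]
      simp only [mul_zero, zero_sub, norm_neg, norm_mul]
      ring
  rw [havg, le_antisymm hge hle, mul_comm ‖a q‖]

theorem norm_excitationPart_sq (u v : ℂ) :
    ‖(WithLp.toLp 2 (excitationPart u v) : EuclideanSpace ℂ (Fin 2 × Fin 2))‖ ^ 2 =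
      ‖u‖ ^ 2 + ‖v‖ ^ 2 := by
  rw [EuclideanSpace.norm_sq_eq, Fintype.sum_prod_type]
  simp [Fin.sum_univ_two, excitationPart, add_comm]

/-- Existence matters: a constant average determines the set of averages only if that set is
nonempty. -/
theorem nonempty_pureDecomposition_wState {N : ℕ} (a : Fin N → ℂ) (ha : ∑ k, ‖a k‖ ^ 2 = 1)
    {p q : Fin N} (h : p ≠ q) : Nonempty (PureDecomposition (reducedPair (wState a) p q)) := by
  obtain ⟨φ, hφ, hφv⟩ := exists_unit_smul_ketBra
    (WithLp.toLp 2 (excitationPart (a p) (a q)) : EuclideanSpace ℂ (Fin 2 × Fin 2))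
  rw [norm_excitationPart_sq] at hφv
  have hs : ∑ k ∈ Finset.univ \ {p, q}, ‖a k‖ ^ 2 + (‖a p‖ ^ 2 + ‖a q‖ ^ 2) = 1 := by
    rw [← Finset.sum_pair h (f := fun k => ‖a k‖ ^ 2),
      Finset.sum_sdiff (Finset.subset_univ _), ha]
  refine ⟨⟨2, ![‖a p‖ ^ 2 + ‖a q‖ ^ 2, ∑ k ∈ Finset.univ \ {p, q}, ‖a k‖ ^ 2],
    ![φ, EuclideanSpace.single (0, 0) 1], ?_, ?_, ?_, ?_⟩⟩
  · rw [Fin.forall_fin_two]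
    have h0 : 0 ≤ ‖a p‖ ^ 2 + ‖a q‖ ^ 2 := by positivity
    have h1 : 0 ≤ ∑ k ∈ Finset.univ \ {p, q}, ‖a k‖ ^ 2 :=
      Finset.sum_nonneg fun k _ => sq_nonneg _
    exact ⟨h0, h1⟩
  · rw [Fin.sum_univ_two]
    exact (add_comm _ _).trans hs
  · rw [Fin.forall_fin_two]
    exact ⟨hφ, by simp⟩
  · rw [Fin.sum_univ_two]
    simp only [Matrix.cons_val_zero, Matrix.cons_val_one]
    rw [hφv]
    ext x y
    rw [reducedPair_wState a h]
    simp only [Matrix.add_apply, Matrix.smul_apply, ketBra, Matrix.of_apply, smul_eq_mul]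
    congr 1
    by_cases hx : x = (0, 0) <;> by_cases hy : y = (0, 0) <;> simp [hx, hy]

theorem averageConcurrences_wState {N : ℕ} (a : Fin N → ℂ) (ha : ∑ k, ‖a k‖ ^ 2 = 1)
    {p q : Fin N} (h : p ≠ q) :
    averageConcurrences (reducedPair (wState a) p q) = {2 * (‖a p‖ * ‖a q‖)} := by
  have := nonempty_pureDecomposition_wState a ha h
  rw [averageConcurrences]
  simp only [PureDecomposition.average_wState a h, Set.range_const]

theorem concurrence_wState {N : ℕ} (a : Fin N → ℂ) (ha : ∑ k, ‖a k‖ ^ 2 = 1)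
    {p q : Fin N} (h : p ≠ q) :
    concurrence (reducedPair (wState a) p q) = 2 * (‖a p‖ * ‖a q‖) := by
  rw [concurrence, averageConcurrences_wState a ha h, csInf_singleton]

theorem concurrenceOfAssistance_wState {N : ℕ} (a : Fin N → ℂ) (ha : ∑ k, ‖a k‖ ^ 2 = 1)
    {p q : Fin N} (h : p ≠ q) :
    concurrenceOfAssistance (reducedPair (wState a) p q) = 2 * (‖a p‖ * ‖a q‖) := by
  rw [concurrenceOfAssistance, averageConcurrences_wState a ha h, csSup_singleton]

/-! ### The cut between a pair and the remaining qubits -/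

theorem trace_reducedState_sq {N : ℕ} (ψ : EuclideanSpace ℂ (Fin N → Fin 2)) {p q : Fin N}
    (h : p ≠ q) :
    (reducedState ψ {p, q} * reducedState ψ {p, q}).trace =
      (reducedPair ψ p q * reducedPair ψ p q).trace := by
  let e := Equiv.ofBijective _ (pairConfig_bijective h)
  have he : reducedPair ψ p q = (reducedState ψ {p, q}).submatrix e e := rfl
  rw [he, Matrix.submatrix_mul_equiv]
  exact (e.sum_comp fun x => (reducedState ψ {p, q} * reducedState ψ {p, q}) x x).symm

theorem pureConcurrence_wState_sq {N : ℕ} (a : Fin N → ℂ) (ha : ∑ k, ‖a k‖ ^ 2 = 1)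
    {p q : Fin N} (h : p ≠ q) :
    pureConcurrence (bipartition {p, q} (wState a)) ^ 2 =
      4 * ((‖a p‖ ^ 2 + ‖a q‖ ^ 2) * ∑ k ∈ Finset.univ \ {p, q}, ‖a k‖ ^ 2) := by
  have hs : ∑ k ∈ Finset.univ \ {p, q}, ‖a k‖ ^ 2 + (‖a p‖ ^ 2 + ‖a q‖ ^ 2) = 1 := by
    rw [← Finset.sum_pair h (f := fun k => ‖a k‖ ^ 2),
      Finset.sum_sdiff (Finset.subset_univ _), ha]
  have hs0 : 0 ≤ ∑ k ∈ Finset.univ \ {p, q}, ‖a k‖ ^ 2 :=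
    Finset.sum_nonneg fun k _ => sq_nonneg _
  have ht : (reducedPair (wState a) p q * reducedPair (wState a) p q).trace =
      (((‖a p‖ ^ 2 + ‖a q‖ ^ 2) ^ 2 + (∑ k ∈ Finset.univ \ {p, q}, ‖a k‖ ^ 2) ^ 2 : ℝ) : ℂ) := by
    simp only [Matrix.trace, Matrix.diag, Matrix.mul_apply, reducedPair_wState a h]
    generalize ∑ k ∈ Finset.univ \ {p, q}, ‖a k‖ ^ 2 = s
    simp only [Fintype.sum_prod_type, Fin.sum_univ_two, excitationPart]
    norm_num
    rw [← Complex.mul_conj', ← Complex.mul_conj']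
    ring
  have hC : pureConcurrence (bipartition {p, q} (wState a)) =
      √(2 * (1 - (reducedState (wState a) {p, q} * reducedState (wState a) {p, q}).trace.re)) := rfl
  rw [hC, trace_reducedState_sq _ h, ht, Complex.ofReal_re]
  generalize ∑ k ∈ Finset.univ \ {p, q}, ‖a k‖ ^ 2 = s at *
  have key : 2 * (1 - ((‖a p‖ ^ 2 + ‖a q‖ ^ 2) ^ 2 + s ^ 2)) =
      4 * ((‖a p‖ ^ 2 + ‖a q‖ ^ 2) * s) := by
    -- With `t = ‖a p‖² + ‖a q‖²`, the sides differ by `2 (1 - (s + t)²)`, which factors through `s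
    -- + t - 1`.
    linear_combination (-2 * (s + (‖a p‖ ^ 2 + ‖a q‖ ^ 2) + 1)) * hs
  rw [key, Real.sq_sqrt (by positivity)]

theorem mainTheorem5 (N : ℕ) (a : Fin N → ℂ) (ha : ∑ k, ‖a k‖ ^ 2 = 1) :
    (∀ p q : Fin N, p ≠ q →
      IsLeast (averageConcurrences (reducedPair (wState a) p q))
        (concurrence (reducedPair (wState a) p q)) ∧
      IsGreatest (averageConcurrences (reducedPair (wState a) p q))
        (concurrenceOfAssistance (reducedPair (wState a) p q)) ∧
      concurrence (reducedPair (wState a) p q) =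
        concurrenceOfAssistance (reducedPair (wState a) p q)) ∧
    (∀ i j : Fin N, i < j →
      |∑ t ∈ Finset.univ \ {i, j}, (concurrence (reducedPair (wState a) i t) ^ 2 -
          concurrence (reducedPair (wState a) j t) ^ 2)| ≤
        pureConcurrence (bipartition {i, j} (wState a)) ^ 2 ∧
      pureConcurrence (bipartition {i, j} (wState a)) ^ 2 ≤
        2 * concurrence (reducedPair (wState a) i j) ^ 2 +
          ∑ t ∈ Finset.univ \ {i, j}, (concurrence (reducedPair (wState a) i t) ^ 2 +
            concurrence (reducedPair (wState a) j t) ^ 2)) := by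
  refine ⟨fun p q h => ?_, fun i j hij => ?_⟩
  · rw [averageConcurrences_wState a ha h, concurrence_wState a ha h,
      concurrenceOfAssistance_wState a ha h]
    exact ⟨isLeast_singleton, isGreatest_singleton, rfl⟩
  · have h := hij.ne
    have hi : ∀ t ∈ Finset.univ \ {i, j}, concurrence (reducedPair (wState a) i t) ^ 2 =
        4 * ‖a i‖ ^ 2 * ‖a t‖ ^ 2 := by
      intro t ht
      simp only [Finset.mem_sdiff, Finset.mem_insert, Finset.mem_singleton, not_or] at ht
      rw [concurrence_wState a ha (Ne.symm ht.2.1)]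
      ring
    have hj : ∀ t ∈ Finset.univ \ {i, j}, concurrence (reducedPair (wState a) j t) ^ 2 =
        4 * ‖a j‖ ^ 2 * ‖a t‖ ^ 2 := by
      intro t ht
      simp only [Finset.mem_sdiff, Finset.mem_insert, Finset.mem_singleton, not_or] at ht
      rw [concurrence_wState a ha (Ne.symm ht.2.2)]
      ring
    have hs0 : 0 ≤ ∑ k ∈ Finset.univ \ {i, j}, ‖a k‖ ^ 2 :=
      Finset.sum_nonneg fun k _ => sq_nonneg _
    rw [pureConcurrence_wState_sq a ha h, Finset.sum_sub_distrib, Finset.sum_add_distrib,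
      Finset.sum_congr rfl hi, Finset.sum_congr rfl hj, ← Finset.mul_sum, ← Finset.mul_sum]
    generalize ∑ k ∈ Finset.univ \ {i, j}, ‖a k‖ ^ 2 = s at *
    have h1 : 0 ≤ ‖a i‖ ^ 2 * s := by positivity
    have h2 : 0 ≤ ‖a j‖ ^ 2 * s := by positivity
    -- The lower bound is `|x - y| ≤ x + y` for nonnegative `x`, `y`; the upper bound only discards
    -- the square in `h3`.
    refine ⟨abs_le.2 ⟨by linarith, by linarith⟩, ?_⟩
    have h3 := sq_nonneg (concurrence (reducedPair (wState a) i j))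
    linarith
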